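/- **Theorem (Hopf Lemma).** Let $n\ge 2$, let $\Omega\subset\mathbb R^n$ be a bounded domain (open and connected), and let $\beta\in(0,1)$. Assume: * $B\in C^{3,\beta}_{loc}((0,\infty))\cap C^1([0,\infty))$, $B(0)=B'(0)=0$, $B,B',B''>0$ on $(0,\infty)$, and there are $p>1$, $k\in[0,1]$, $\gamma,\Gamma>0$ with $\gamma(k+t)^{p-2}t\le B'(t)\le\Gamma(k+t)^{p-2}t$ and $\gamma(k+t)^{p-2}\le B''(t)\le\Gamma(k+t)^{p-2}$ for all $t>0$. * $H:\mathbb R^n\to[0,\infty)$ is even, $H(0)=0$, $H\in C^{3,\beta}_{loc}(\mathbb R^n\setminus\{0\})$, $H(\xi)>0$ and $H(t\xi)=tH(\xi)$ for $\xi\ne0$, $t>0$, and there is $\lambda>0$ with $\langle D^2H(\xi)v,v\rangle\ge\lambda|v|^2$ whenever $H(\xi)=1$ and $\langle\nabla H(\xi),v\rangle=0$. * $f$ is a nonnegative continuous function on $[0,\infty)$, locally Lipschitz on $(0,\infty)$, and there are $\delta>0$ and $g\in C^0([0,\infty))$, non-decreasing on $(0,\delta)$, with $g(0)=0$, $f+g\ge0$,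 and either $g=0$ on $[0,d]$ for some $d>0$, or $\int_0^\delta \frac{ds}{L^{-1}(G(s))}=+\infty$, where $G(s)=\int_0^s g(t)\,dt$ and $L(s)=sB'(s)-B(s)$. Let $u\in C^1(\overline\Omega)$ (that is, $u$ is continuous on $\overline\Omega$ and $C^1$ in $\Omega$, and $\nabla u$ extends continuously to $\overline\Omega$) be a weak solution of $-\operatorname{div}\big(B'(H(\nabla u))\nabla H(\nabla u)\big)=f(u)$ in $\Omega$, i.e. $$\int_\Omega B'(H(\nabla u))\langle\nabla H(\nabla u),\nabla\psi\rangle\,dx=\int_\Omega f(u)\psi\,dx\qquad\text{for all }\psi\in C^1_c(\Omega),$$ with $u>0$ in $\Omega$ and $u=0$ on $\partial\Omega$. Let $y\in\partial\Omega$ be a point at which $\Omega$ satisfies the interior sphere condition: there is an open ball contained in $\Omega$ with $y$ on its boundary. If $\nu$ is the inner unit normal to $\partial\Omega$ at $y$, then the one-sided derivative of $u$ at $y$ in the direction $\nu$ exists and $$\frac{\partial u}{\partial\nu}(y)>0 .$$ Here $\nu$ is the inner unit normal at $y$ if $|\nu|=1$ and, for every $\varepsilon>0$, all $x$ close enough to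 $y$ satisfy: $x\in\Omega$ if $\langle x-y,\nu\rangle>\varepsilon|x-y|$, and $x\notin\Omega$ if $\langle x-y,\nu\rangle<-\varepsilon|x-y|$ (for a $C^1$ boundary this is the usual normal). The same conclusion holds, without requiring that $\partial\Omega$ has a normal at $y$, for the inner unit normal $\nu$ at $y$ of any ball contained in $\Omega$ with $y$ on its boundary. -/

import Mathlib

open Set Filter Topology MeasureTheory
open scoped NNReal ENNReal

noncomputable section

namespace AnisotropicHopf

/-- `φ ∈ C^{3,β}_loc(U)`, for an open set `U`: `φ` is `C³` on `U` and its third derivative is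
`β`-Hölder continuous on every compact subset of `U`. -/
def IsC3HolderLoc {E : Type*} [NormedAddCommGroup E] [NormedSpace ℝ E]
    (β : ℝ≥0) (φ : E → ℝ) (U : Set E) : Prop :=
  ContDiffOn ℝ 3 φ U ∧
    ∀ K : Set E, K ⊆ U → IsCompact K →
      ∃ C : ℝ≥0, HolderOnWith C β (iteratedFDeriv ℝ 3 φ) K

/-- The derivative `B'` of a function `B` on `[0, ∞)`, one-sided at `0`. -/
def dB (B : ℝ → ℝ) : ℝ → ℝ := derivWithin B (Ici 0)

/-- The hypotheses on `B`: regularity, signs, and growth of order `p > 1`. -/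
structure AdmissibleB (β : ℝ≥0) (B : ℝ → ℝ) : Prop where
  holder : IsC3HolderLoc β B (Ioi 0)
  contDiff : ContDiffOn ℝ 1 B (Ici 0)
  zero : B 0 = 0
  deriv_zero : dB B 0 = 0
  pos : ∀ t : ℝ, 0 < t → 0 < B t ∧ 0 < dB B t ∧ 0 < deriv (dB B) t
  growth : ∃ p k γ Γ : ℝ, 1 < p ∧ 0 ≤ k ∧ k ≤ 1 ∧ 0 < γ ∧ 0 < Γ ∧
    ∀ t : ℝ, 0 < t →
      γ * (k + t) ^ (p - 2) * t ≤ dB B t ∧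
      dB B t ≤ Γ * (k + t) ^ (p - 2) * t ∧
      γ * (k + t) ^ (p - 2) ≤ deriv (dB B) t ∧
      deriv (dB B) t ≤ Γ * (k + t) ^ (p - 2)

/-- The hypotheses on the norm `H`: regularity off the origin, evenness, positivity,
homogeneity and uniform ellipticity. By homogeneity `{H = 1}` is the boundary of `{H < 1}`. -/
structure AdmissibleH {n : ℕ} (β : ℝ≥0) (H : EuclideanSpace ℝ (Fin n) → ℝ) : Prop where
  holder : IsC3HolderLoc β H {0}ᶜ
  zero : H 0 = 0
  even : ∀ ξ, H (-ξ) = H ξ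
  pos : ∀ ξ, ξ ≠ 0 → 0 < H ξ
  homogeneous : ∀ ξ, ξ ≠ 0 → ∀ t : ℝ, 0 < t → H (t • ξ) = t * H ξ
  elliptic : ∃ lam : ℝ, 0 < lam ∧ ∀ ξ, H ξ = 1 →
    ∀ v, inner ℝ (gradient H ξ) v = 0 →
      lam * ‖v‖ ^ 2 ≤ fderiv ℝ (fderiv ℝ H) ξ v v

/-- The function `L(s) = s B'(s) - B(s)`; under the hypotheses on `B` it is an increasing
bijection of `[0, ∞)` onto itself. -/
def legendreL (B : ℝ → ℝ) (s : ℝ) : ℝ := s * dB B s - B s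

/-- The inverse of `L` on `[0, ∞)`. -/
def legendreLInv (B : ℝ → ℝ) : ℝ → ℝ := Function.invFunOn (legendreL B) (Ici 0)

/-- The hypotheses on the source `f` on `[0, ∞)`. The last one is the Vázquez type condition; the
integral is an integral of a nonnegative extended real function. -/
structure AdmissibleF (B f : ℝ → ℝ) : Prop where
  continuousOn : ContinuousOn f (Ici 0)
  nonneg : ∀ s : ℝ, 0 ≤ s → 0 ≤ f s
  locallyLipschitz : LocallyLipschitzOn (Ioi 0) f
  vazquez : ∃ (g : ℝ → ℝ) (δ : ℝ), ContinuousOn g (Ici 0) ∧ 0 < δ ∧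
    MonotoneOn g (Ioo 0 δ) ∧ g 0 = 0 ∧ (∀ s : ℝ, 0 ≤ s → 0 ≤ f s + g s) ∧
    ((∃ d : ℝ, 0 < d ∧ ∀ s ∈ Icc 0 d, g s = 0) ∨
      ∫⁻ s in Ioo 0 δ, (ENNReal.ofReal (legendreLInv B (∫ t in (0 : ℝ)..s, g t)))⁻¹ = ⊤)

/-- `u ∈ C¹(closure Ω)`: `u` is continuous on `closure Ω`, differentiable in `Ω`, and its gradient
extends continuously to `closure Ω`. -/
def IsC1Closure {n : ℕ} (Ω : Set (EuclideanSpace ℝ (Fin n)))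
    (u : EuclideanSpace ℝ (Fin n) → ℝ) : Prop :=
  ContinuousOn u (closure Ω) ∧
    ∃ Du : EuclideanSpace ℝ (Fin n) → EuclideanSpace ℝ (Fin n),
      ContinuousOn Du (closure Ω) ∧ ∀ x ∈ Ω, HasGradientAt u (Du x) x

/-- `u` is a weak solution of `-div (B'(H(∇u)) ∇H(∇u)) = f(u)` in `Ω`, tested against `C¹_c(Ω)`.
Where `∇u = 0` the factor `B'(H(0)) = B'(0)` vanishes, so the value of `∇H` at `0` is
irrelevant. -/
def IsWeakSolution {n : ℕ} (B : ℝ → ℝ) (H : EuclideanSpace ℝ (Fin n) → ℝ) (f : ℝ → ℝ)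
    (Ω : Set (EuclideanSpace ℝ (Fin n))) (u : EuclideanSpace ℝ (Fin n) → ℝ) : Prop :=
  ∀ ψ : EuclideanSpace ℝ (Fin n) → ℝ,
    ContDiff ℝ 1 ψ → HasCompactSupport ψ → tsupport ψ ⊆ Ω →
      ∫ x in Ω, dB B (H (gradient u x)) *
          inner ℝ (gradient H (gradient u x)) (gradient ψ x) =
        ∫ x in Ω, f (u x) * ψ x

/-- `Ω` contains a ball of radius `R` that touches `y` and whose inner unit normal at `y`
is `ν`. -/
def IsInteriorSphere {n : ℕ} (Ω : Set (EuclideanSpace ℝ (Fin n)))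
    (y ν : EuclideanSpace ℝ (Fin n)) (R : ℝ) : Prop :=
  0 < R ∧ ‖ν‖ = 1 ∧ Metric.ball (y + R • ν) R ⊆ Ω

/-- The interior sphere condition at `y`: some open ball contained in `Ω` has `y` on its
boundary. -/
def InteriorSphereCondition {n : ℕ} (Ω : Set (EuclideanSpace ℝ (Fin n)))
    (y : EuclideanSpace ℝ (Fin n)) : Prop :=
  ∃ (c : EuclideanSpace ℝ (Fin n)) (R : ℝ), 0 < R ∧ Metric.ball c R ⊆ Ω ∧
    y ∈ Metric.sphere c R

/-- `ν` is the inner unit normal to `∂Ω` at `y`: up to cones of arbitrarily small opening around the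
hyperplane `ν^⊥`, near `y` the set `Ω` is the half-space `⟨x - y, ν⟩ > 0`. For domains with `C¹`
boundary this is the usual inner unit normal. -/
def IsInnerUnitNormal {n : ℕ} (Ω : Set (EuclideanSpace ℝ (Fin n)))
    (y ν : EuclideanSpace ℝ (Fin n)) : Prop :=
  ‖ν‖ = 1 ∧ ∀ ε : ℝ, 0 < ε → ∀ᶠ x in 𝓝 y,
    (ε * ‖x - y‖ < inner ℝ (x - y) ν → x ∈ Ω) ∧
    (inner ℝ (x - y) ν < -(ε * ‖x - y‖) → x ∉ Ω)

/-- The one-sided directional derivative of `u` at `y` in the direction `ν` exists and is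
positive. -/
def HasPosDirDeriv {n : ℕ} (u : EuclideanSpace ℝ (Fin n) → ℝ)
    (y ν : EuclideanSpace ℝ (Fin n)) : Prop :=
  ∃ d : ℝ, HasDerivWithinAt (fun t : ℝ => u (y + t • ν)) d (Ici 0) 0 ∧ 0 < d

end AnisotropicHopf

end

/-! Hopf's barrier argument. Since `f(u) ≥ 0`, `u` is a weak supersolution of the operator without
source. In the annulus `R/2 < |x - c| < R` of an interior ball, `u` is compared with `v = ε
(exp(-α|x - c|²) - exp(-αR²))`. On the inner sphere `v ≤ ε ≤ u`, with `ε` a positive lower bound of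
`u` there; on the outer sphere `v = 0 ≤ u`. Hence `v ≤ u` in the annulus, with equality at `y`, and
the normal derivative of `u` at `y` is at least that of `v`, which is positive.

Two facts carry this. First, `v` is a strict subsolution for large `α`
(`exists_sum_fderiv_barrier_flux_neg`). Its gradient is a negative multiple of `x - c` and `∇H` is
odd and `0`-homogeneous, so the flux is explicit and smooth off `c`. The bound `B'(t) ≤ K t B''(t)`
lets the term in `-α` absorb the others uniformly in `ε`, so `α` can be fixed independently of `ε`.
Second, comparison (`barrier_le`) needs only the weak monotonicity `flux_monotone`, because the
strict inequality comes from `v`: testing with a truncated square of `v - u` gives a negative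
integral for `v` and a nonnegative one for `u`, in the order opposite to the one monotonicity
imposes.

For a normal of `∂Ω`, `IsInnerUnitNormal.eq_of_isInteriorSphere` identifies it with the normal of
the ball. -/

namespace AnisotropicHopf

/-! ### Homogeneity and convexity of `H`. -/

section Norm

variable {n : ℕ} {β : ℝ≥0} {H : EuclideanSpace ℝ (Fin n) → ℝ}

theorem AdmissibleH.contDiffAt (hH : AdmissibleH β H) {ξ : EuclideanSpace ℝ (Fin n)}
    (hξ : ξ ≠ 0) : ContDiffAt ℝ 3 H ξ :=
  hH.holder.1.contDiffAt (isOpen_compl_singleton.mem_nhds hξ)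

theorem AdmissibleH.differentiableAt (hH : AdmissibleH β H) {ξ : EuclideanSpace ℝ (Fin n)}
    (hξ : ξ ≠ 0) : DifferentiableAt ℝ H ξ :=
  (hH.contDiffAt hξ).differentiableAt (by norm_num)

theorem AdmissibleH.contDiffAt_fderiv (hH : AdmissibleH β H) {ξ : EuclideanSpace ℝ (Fin n)}
    (hξ : ξ ≠ 0) : ContDiffAt ℝ 2 (fderiv ℝ H) ξ :=
  (hH.contDiffAt hξ).fderiv_right (by norm_num)

theorem AdmissibleH.differentiableAt_fderiv (hH : AdmissibleH β H)
    {ξ : EuclideanSpace ℝ (Fin n)} (hξ : ξ ≠ 0) : DifferentiableAt ℝ (fderiv ℝ H) ξ :=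
  (hH.contDiffAt_fderiv hξ).differentiableAt (by norm_num)

theorem AdmissibleH.nonneg (hH : AdmissibleH β H) (ξ : EuclideanSpace ℝ (Fin n)) : 0 ≤ H ξ := by
  rcases eq_or_ne ξ 0 with rfl | h
  · exact hH.zero.ge
  · exact (hH.pos ξ h).le

theorem AdmissibleH.smul (hH : AdmissibleH β H) (ξ : EuclideanSpace ℝ (Fin n)) {t : ℝ}
    (ht : 0 < t) : H (t • ξ) = t * H ξ := by
  rcases eq_or_ne ξ 0 with rfl | h
  · simp [hH.zero]
  · exact hH.homogeneous ξ h t ht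

theorem AdmissibleH.fderiv_smul (hH : AdmissibleH β H) (ξ : EuclideanSpace ℝ (Fin n))
    {t : ℝ} (ht : 0 < t) : fderiv ℝ H (t • ξ) = fderiv ℝ H ξ := by
  have h1 : fderiv ℝ (fun x => H (t • x)) ξ = t • fderiv ℝ H (t • ξ) := fderiv_comp_smul t
  have h2 : (fun x => H (t • x)) = fun x => t • H x := by
    ext x; simp [hH.smul x ht]
  rw [h2] at h1
  have h3 : fderiv ℝ (fun x => t • H x) ξ = t • fderiv ℝ H ξ := by
    exact congrFun (fderiv_const_smul_field (𝕜 := ℝ) (f := H) t) ξ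
  rw [h3] at h1
  exact (smul_right_injective _ ht.ne' h1).symm

theorem AdmissibleH.fderiv_neg (hH : AdmissibleH β H) (ξ : EuclideanSpace ℝ (Fin n)) :
    fderiv ℝ H (-ξ) = -fderiv ℝ H ξ := by
  have h1 : fderiv ℝ (fun x => H ((-1 : ℝ) • x)) ξ = (-1 : ℝ) • fderiv ℝ H ((-1 : ℝ) • ξ) :=
    fderiv_comp_smul (-1)
  have h2 : (fun x => H ((-1 : ℝ) • x)) = H := by ext x; simp [hH.even x]
  rw [h2] at h1
  rw [h1]; simp

/-- Euler's identity `⟨∇H(ξ), ξ⟩ = H(ξ)`. -/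
theorem AdmissibleH.fderiv_self (hH : AdmissibleH β H) {ξ : EuclideanSpace ℝ (Fin n)}
    (hξ : ξ ≠ 0) : fderiv ℝ H ξ ξ = H ξ := by
  have h1 : HasDerivAt (fun t : ℝ => H (t • ξ)) (fderiv ℝ H ξ ξ) 1 := by
    have h : HasFDerivAt H (fderiv ℝ H ξ) ((1 : ℝ) • ξ) := by
      simpa using (hH.differentiableAt hξ).hasFDerivAt
    have h' : HasDerivAt (fun t : ℝ => t • ξ) ((1 : ℝ) • ξ) 1 := (hasDerivAt_id 1).smul_const ξ
    simpa [Function.comp_def] using! h.comp_hasDerivAt (1 : ℝ) h'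
  have h2 : HasDerivAt (fun t : ℝ => t * H ξ) (H ξ) 1 := by
    simpa using (hasDerivAt_id (1 : ℝ)).mul_const (H ξ)
  have h3 : (fun t : ℝ => H (t • ξ)) =ᶠ[𝓝 1] fun t => t * H ξ := by
    filter_upwards [Ioi_mem_nhds (zero_lt_one (α := ℝ))] with t ht using hH.smul ξ ht
  exact h1.unique (h2.congr_of_eventuallyEq h3)

/-- `∇H` is constant along rays, so the Hessian kills the radial direction. -/
theorem AdmissibleH.fderiv_fderiv_self (hH : AdmissibleH β H) {ξ : EuclideanSpace ℝ (Fin n)}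
    (hξ : ξ ≠ 0) : fderiv ℝ (fderiv ℝ H) ξ ξ = 0 := by
  have h1 : HasDerivAt (fun t : ℝ => fderiv ℝ H (t • ξ)) (fderiv ℝ (fderiv ℝ H) ξ ξ) 1 := by
    have h : HasFDerivAt (fderiv ℝ H) (fderiv ℝ (fderiv ℝ H) ξ) ((1 : ℝ) • ξ) := by
      simpa using (hH.differentiableAt_fderiv hξ).hasFDerivAt
    have h' : HasDerivAt (fun t : ℝ => t • ξ) ((1 : ℝ) • ξ) 1 := (hasDerivAt_id 1).smul_const ξ
    simpa [Function.comp_def] using! h.comp_hasDerivAt (1 : ℝ) h'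
  have h3 : (fun t : ℝ => fderiv ℝ H (t • ξ)) =ᶠ[𝓝 1] fun _ => fderiv ℝ H ξ := by
    filter_upwards [Ioi_mem_nhds (zero_lt_one (α := ℝ))] with t ht using hH.fderiv_smul ξ ht
  exact h1.unique ((hasDerivAt_const (1 : ℝ) _).congr_of_eventuallyEq h3)

theorem AdmissibleH.fderiv_fderiv_smul (hH : AdmissibleH β H) (ξ : EuclideanSpace ℝ (Fin n))
    {t : ℝ} (ht : 0 < t) :
    t • fderiv ℝ (fderiv ℝ H) (t • ξ) = fderiv ℝ (fderiv ℝ H) ξ := by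
  have h1 : fderiv ℝ (fun x => fderiv ℝ H (t • x)) ξ = t • fderiv ℝ (fderiv ℝ H) (t • ξ) :=
    fderiv_comp_smul t
  rw [← h1]
  congr 1
  ext1 x
  exact hH.fderiv_smul x ht

/-- The Hessian of `H` is positive semidefinite off the origin. -/
theorem AdmissibleH.fderiv_fderiv_nonneg (hH : AdmissibleH β H)
    {ξ : EuclideanSpace ℝ (Fin n)} (hξ : ξ ≠ 0) (v : EuclideanSpace ℝ (Fin n)) :
    0 ≤ fderiv ℝ (fderiv ℝ H) ξ v v := by
  have hpos := hH.pos ξ hξ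
  -- By Euler's identity this `a` makes `w = v - a ξ` tangent to the level set of `H`. The radial
  -- part does not contribute to the Hessian, and ellipticity applies to `w` after rescaling `ξ` to
  -- `{H = 1}`.
  set a := fderiv ℝ H ξ v / H ξ with ha
  set w := v - a • ξ with hw
  have hv : v = a • ξ + w := by simp [hw]
  have hsymm : fderiv ℝ (fderiv ℝ H) ξ w ξ = fderiv ℝ (fderiv ℝ H) ξ ξ w :=
    (hH.contDiffAt hξ).isSymmSndFDerivAt (by norm_num) w ξ
  have hvv : fderiv ℝ (fderiv ℝ H) ξ v v = fderiv ℝ (fderiv ℝ H) ξ w w := by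
    conv_lhs => rw [hv]
    simp [hH.fderiv_fderiv_self hξ, hsymm]
  have hw0 : fderiv ℝ H ξ w = 0 := by
    rw [hw, map_sub, map_smul, hH.fderiv_self hξ, ha, smul_eq_mul, div_mul_cancel₀ _ hpos.ne',
      sub_self]
  obtain ⟨lam, hlam, hell⟩ := hH.elliptic
  have ht : 0 < (H ξ)⁻¹ := inv_pos.2 hpos
  have h1 : H ((H ξ)⁻¹ • ξ) = 1 := by rw [hH.smul ξ ht, inv_mul_cancel₀ hpos.ne']
  have h2 := hell _ h1 w (by rw [inner_gradient_left, hH.fderiv_smul ξ ht, hw0])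
  have h3 : 0 ≤ fderiv ℝ (fderiv ℝ H) ((H ξ)⁻¹ • ξ) w w := le_trans (by positivity) h2
  rw [hvv, ← hH.fderiv_fderiv_smul ξ ht]
  simpa using mul_nonneg ht.le h3

/-- The tangent plane inequality for `H`, i.e. the gradient of `H` has dual norm at most `1`. -/
theorem AdmissibleH.fderiv_le (hH : AdmissibleH β H) {ξ : EuclideanSpace ℝ (Fin n)}
    (hξ : ξ ≠ 0) (η : EuclideanSpace ℝ (Fin n)) : fderiv ℝ H ξ η ≤ H η := by
  -- Off the origin the inequality is convexity along the segment from `ξ` to `η`. If the segment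
  -- meets the origin, `η` is a nonpositive multiple of `ξ` and the left side is nonpositive by
  -- Euler's identity.
  by_cases hseg : ∀ t ∈ Icc (0 : ℝ) 1, ξ + t • (η - ξ) ≠ 0
  · have hd : ∀ t ∈ Icc (0 : ℝ) 1, HasDerivAt (fun t : ℝ => H (ξ + t • (η - ξ)))
        (fderiv ℝ H (ξ + t • (η - ξ)) (η - ξ)) t := by
      intro t ht
      have h' : HasDerivAt (fun t : ℝ => ξ + t • (η - ξ)) (η - ξ) t := by
        simpa using ((hasDerivAt_id t).smul_const (η - ξ)).const_add ξ
      exact (hH.differentiableAt (hseg t ht)).hasFDerivAt.comp_hasDerivAt t h'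
    have hd2 : ∀ t ∈ Icc (0 : ℝ) 1,
        HasDerivAt (fun t : ℝ => fderiv ℝ H (ξ + t • (η - ξ)) (η - ξ))
        (fderiv ℝ (fderiv ℝ H) (ξ + t • (η - ξ)) (η - ξ) (η - ξ)) t := by
      intro t ht
      have h' : HasDerivAt (fun t : ℝ => ξ + t • (η - ξ)) (η - ξ) t := by
        simpa using ((hasDerivAt_id t).smul_const (η - ξ)).const_add ξ
      have := (hH.differentiableAt_fderiv (hseg t ht)).hasFDerivAt.comp_hasDerivAt t h'
      simpa using this.clm_apply (hasDerivAt_const t (η - ξ))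
    have hconv : ConvexOn ℝ (Icc (0 : ℝ) 1) (fun t : ℝ => H (ξ + t • (η - ξ))) := by
      refine convexOn_of_hasDerivWithinAt2_nonneg (convex_Icc 0 1)
        (f' := fun t => fderiv ℝ H (ξ + t • (η - ξ)) (η - ξ))
        (f'' := fun t => fderiv ℝ (fderiv ℝ H) (ξ + t • (η - ξ)) (η - ξ) (η - ξ))
        (fun t ht => (hd t ht).continuousAt.continuousWithinAt) ?_ ?_ ?_
      · intro t ht; exact (hd t (interior_subset ht)).hasDerivWithinAt
      · intro t ht; exact (hd2 t (interior_subset ht)).hasDerivWithinAt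
      · intro t ht; exact hH.fderiv_fderiv_nonneg (hseg t (interior_subset ht)) _
    have h0 := hd 0 (by simp)
    have := hconv.le_slope_of_hasDerivAt (x := 0) (y := 1) (by simp) (by simp) one_pos h0
    simp only [slope_def_field, zero_smul, add_zero, one_smul, add_sub_cancel, sub_zero,
      div_one, map_sub, hH.fderiv_self hξ] at this
    linarith
  · push Not at hseg
    obtain ⟨t, ht, h0⟩ := hseg
    have ht0 : t ≠ 0 := by rintro rfl; simp [hξ] at h0
    have htpos : 0 < t := lt_of_le_of_ne ht.1 ht0.symm
    have hη : t • η = -((1 - t) • ξ) := by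
      rw [eq_neg_iff_add_eq_zero, ← h0]; module
    have h1 : t * fderiv ℝ H ξ η = -((1 - t) * H ξ) := by
      rw [← smul_eq_mul, ← map_smul, hη, map_neg, map_smul, hH.fderiv_self hξ, smul_eq_mul]
    have h2 : 0 ≤ (1 - t) * H ξ := mul_nonneg (by linarith [ht.2]) (hH.nonneg ξ)
    have h3 : fderiv ℝ H ξ η ≤ 0 := by
      by_contra h; push Not at h
      nlinarith [mul_pos htpos h]
    exact h3.trans (hH.nonneg η)

theorem AdmissibleH.exists_le_norm (hH : AdmissibleH β H) : ∃ M : ℝ, ∀ ξ, H ξ ≤ M * ‖ξ‖ := by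
  have hK : IsCompact (Metric.sphere (0 : EuclideanSpace ℝ (Fin n)) 1) := isCompact_sphere 0 1
  have hne : ∀ ξ ∈ Metric.sphere (0 : EuclideanSpace ℝ (Fin n)) 1, ξ ≠ 0 := by
    rintro ξ hξ rfl; simp at hξ
  obtain ⟨M, hM⟩ := hK.bddAbove_image (f := H)
    fun ξ hξ => (hH.differentiableAt (hne ξ hξ)).continuousAt.continuousWithinAt
  refine ⟨M, fun ξ => ?_⟩
  rcases eq_or_ne ξ 0 with rfl | h
  · simp [hH.zero]
  have hpos : 0 < ‖ξ‖ := norm_pos_iff.2 h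
  have h1 : H (‖ξ‖⁻¹ • ξ) ≤ M := hM ⟨_, by simp [norm_smul, hpos.ne'], rfl⟩
  rw [hH.smul ξ (inv_pos.2 hpos), inv_mul_le_iff₀ hpos] at h1
  linarith

theorem AdmissibleH.continuous (hH : AdmissibleH β H) : Continuous H := by
  refine continuous_iff_continuousAt.2 fun ξ => ?_
  rcases eq_or_ne ξ 0 with rfl | h
  · obtain ⟨M, hM⟩ := hH.exists_le_norm
    have h2 : Tendsto (fun ξ : EuclideanSpace ℝ (Fin n) => M * ‖ξ‖) (𝓝 0) (𝓝 0) := by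
      have : Continuous fun ξ : EuclideanSpace ℝ (Fin n) => M * ‖ξ‖ := by fun_prop
      simpa using this.tendsto 0
    rw [ContinuousAt, hH.zero]
    exact squeeze_zero hH.nonneg hM h2
  · exact (hH.differentiableAt h).continuousAt

end Norm

/-! ### Monotonicity and growth of `B'`. -/

section Young

variable {β : ℝ≥0} {B : ℝ → ℝ}

theorem AdmissibleB.contDiffAt_dB (hB : AdmissibleB β B) {t : ℝ} (ht : 0 < t) :
    ContDiffAt ℝ 2 (dB B) t := by
  have h1 : ContDiffOn ℝ 2 (deriv B) (Ioi 0) :=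
    hB.holder.1.deriv_of_isOpen isOpen_Ioi (by norm_num)
  refine (h1.contDiffAt (Ioi_mem_nhds ht)).congr_of_eventuallyEq ?_
  filter_upwards [Ioi_mem_nhds ht] with s hs
  exact derivWithin_of_mem_nhds (Ici_mem_nhds hs)

theorem AdmissibleB.differentiableAt_dB (hB : AdmissibleB β B) {t : ℝ} (ht : 0 < t) :
    DifferentiableAt ℝ (dB B) t :=
  (hB.contDiffAt_dB ht).differentiableAt (by norm_num)

theorem AdmissibleB.continuousOn_dB (hB : AdmissibleB β B) : ContinuousOn (dB B) (Ici 0) :=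
  hB.contDiff.continuousOn_derivWithin (uniqueDiffOn_Ici 0) le_rfl

theorem AdmissibleB.monotoneOn_dB (hB : AdmissibleB β B) : MonotoneOn (dB B) (Ici 0) := by
  refine monotoneOn_of_deriv_nonneg (convex_Ici 0) hB.continuousOn_dB ?_ ?_
  · rw [interior_Ici]
    exact fun t ht => (hB.differentiableAt_dB ht).differentiableWithinAt
  · rw [interior_Ici]
    exact fun t ht => (hB.pos t ht).2.2.le

theorem AdmissibleB.dB_nonneg (hB : AdmissibleB β B) {t : ℝ} (ht : 0 ≤ t) : 0 ≤ dB B t := by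
  have := hB.monotoneOn_dB (mem_Ici.2 le_rfl) (mem_Ici.2 ht) ht
  rwa [hB.deriv_zero] at this

/-- The factor `(k + t)^(p - 2)` is common to the upper bound of `B'` and the lower bound of `B''`,
so it cancels. Being uniform in `t`, the bound makes the choice of `α` independent of `ε`. -/
theorem AdmissibleB.exists_dB_le (hB : AdmissibleB β B) :
    ∃ K : ℝ, 0 < K ∧ ∀ t : ℝ, 0 < t → dB B t ≤ K * (t * deriv (dB B) t) := by
  obtain ⟨p, k, γ, Γ, -, -, -, hγ, hΓ, h⟩ := hB.growth
  refine ⟨Γ / γ, by positivity, fun t ht => ?_⟩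
  obtain ⟨-, h2, h3, -⟩ := h t ht
  calc dB B t ≤ Γ * (k + t) ^ (p - 2) * t := h2
    _ = Γ / γ * (t * (γ * (k + t) ^ (p - 2))) := by field_simp
    _ ≤ _ := by gcongr

end Young

/-! ### Monotonicity and continuity of the flux. -/

section Flux

variable {n : ℕ} {β : ℝ≥0} {B : ℝ → ℝ} {H : EuclideanSpace ℝ (Fin n) → ℝ}

/-- The vector field `ξ ↦ B'(H(ξ)) ∇H(ξ)`. -/
noncomputable def flux (B : ℝ → ℝ) (H : EuclideanSpace ℝ (Fin n) → ℝ)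
    (ξ : EuclideanSpace ℝ (Fin n)) : EuclideanSpace ℝ (Fin n) :=
  dB B (H ξ) • gradient H ξ

theorem inner_flux (ξ v : EuclideanSpace ℝ (Fin n)) :
    inner ℝ (flux B H ξ) v = dB B (H ξ) * fderiv ℝ H ξ v := by
  rw [flux, real_inner_smul_left, inner_gradient_left]

theorem flux_zero (hB : AdmissibleB β B) (hH : AdmissibleH β H) : flux B H 0 = 0 := by
  simp [flux, hH.zero, hB.deriv_zero]

theorem inner_flux_le (hB : AdmissibleB β B) (hH : AdmissibleH β H)
    (ξ v : EuclideanSpace ℝ (Fin n)) : inner ℝ (flux B H ξ) v ≤ dB B (H ξ) * H v := by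
  rcases eq_or_ne ξ 0 with rfl | h
  · simp [flux_zero hB hH, hH.zero, hB.deriv_zero]
  · rw [inner_flux]
    exact mul_le_mul_of_nonneg_left (hH.fderiv_le h v) (hB.dB_nonneg (hH.nonneg ξ))

theorem inner_flux_self (hH : AdmissibleH β H)
    (ξ : EuclideanSpace ℝ (Fin n)) : inner ℝ (flux B H ξ) ξ = dB B (H ξ) * H ξ := by
  rcases eq_or_ne ξ 0 with rfl | h
  · simp [hH.zero]
  · rw [inner_flux, hH.fderiv_self h]

/-- Bounding the cross terms by `inner_flux_le` leaves `(B'(H ξ) - B'(H η)) (H ξ - H η)`,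
nonnegative because `B'` is monotone. -/
theorem flux_monotone (hB : AdmissibleB β B) (hH : AdmissibleH β H)
    (ξ η : EuclideanSpace ℝ (Fin n)) :
    0 ≤ inner ℝ (flux B H ξ - flux B H η) (ξ - η) := by
  have h1 := inner_flux_le hB hH ξ η
  have h2 := inner_flux_le hB hH η ξ
  have h3 : 0 ≤ (dB B (H ξ) - dB B (H η)) * (H ξ - H η) := by
    rcases le_total (H ξ) (H η) with h | h
    · have := hB.monotoneOn_dB (mem_Ici.2 (hH.nonneg ξ)) (mem_Ici.2 (hH.nonneg η)) h
      exact mul_nonneg_of_nonpos_of_nonpos (by linarith) (by linarith)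
    · have := hB.monotoneOn_dB (mem_Ici.2 (hH.nonneg η)) (mem_Ici.2 (hH.nonneg ξ)) h
      exact mul_nonneg (by linarith) (by linarith)
  rw [inner_sub_left, inner_sub_right, inner_sub_right, inner_flux_self hH,
    inner_flux_self hH]
  linarith

/-- Only the origin is delicate. `inner_flux_le`, applied with the flux itself as the vector, bounds
its norm by `M B'(H ξ)`, which tends to `B'(0) = 0`. -/
theorem continuous_flux (hB : AdmissibleB β B) (hH : AdmissibleH β H) :
    Continuous (flux B H) := by
  have hdB : Continuous fun ξ => dB B (H ξ) :=
    hB.continuousOn_dB.comp_continuous hH.continuous fun ξ => hH.nonneg ξ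
  refine continuous_iff_continuousAt.2 fun ξ => ?_
  rcases eq_or_ne ξ 0 with rfl | h
  · obtain ⟨M, hM⟩ := hH.exists_le_norm
    rw [ContinuousAt, flux_zero hB hH]
    have h2 : Tendsto (fun ξ => dB B (H ξ) * M) (𝓝 0) (𝓝 0) := by
      simpa [hH.zero, hB.deriv_zero] using (hdB.mul_const M).tendsto 0
    refine squeeze_zero_norm (fun ξ => ?_) h2
    have h3 := (inner_flux_le hB hH ξ (flux B H ξ)).trans
      (mul_le_mul_of_nonneg_left (hM _) (hB.dB_nonneg (hH.nonneg ξ)))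
    rw [real_inner_self_eq_norm_sq] at h3
    rcases eq_or_lt_of_le (norm_nonneg (flux B H ξ)) with h0 | h0
    · rw [← h0]
      rcases eq_or_ne ξ 0 with rfl | hξ
      · simp [hH.zero, hB.deriv_zero]
      · have hMξ := (hH.pos ξ hξ).le.trans (hM ξ)
        have : 0 ≤ M := nonneg_of_mul_nonneg_left hMξ (norm_pos_iff.2 hξ)
        exact mul_nonneg (hB.dB_nonneg (hH.nonneg ξ)) this
    · nlinarith
  · have hg : ContinuousAt (gradient H) ξ :=
      (InnerProductSpace.toDual ℝ _).symm.continuous.continuousAt.comp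
        (hH.contDiffAt_fderiv h).continuousAt
    exact hdB.continuousAt.smul hg

end Flux

/-! ### The exponential barrier and its divergence. -/

section Barrier

variable {n : ℕ} {β : ℝ≥0} {B : ℝ → ℝ} {H : EuclideanSpace ℝ (Fin n) → ℝ}

/-- The factor `m` in the identity `∇v(x) = -m(x) (x - c)` for the radial barrier `v`. -/
noncomputable def barrierSlope (c : EuclideanSpace ℝ (Fin n)) (α ε : ℝ)
    (x : EuclideanSpace ℝ (Fin n)) : ℝ :=
  2 * α * ε * Real.exp (-α * ‖x - c‖ ^ 2)

/-- The radial barrier `ε (exp(-α|x - c|²) - exp(-α r²))`. -/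
noncomputable def barrier (c : EuclideanSpace ℝ (Fin n)) (r α ε : ℝ)
    (x : EuclideanSpace ℝ (Fin n)) : ℝ :=
  ε * (Real.exp (-α * ‖x - c‖ ^ 2) - Real.exp (-α * r ^ 2))

theorem barrierSlope_pos (c : EuclideanSpace ℝ (Fin n)) {α ε : ℝ} (hα : 0 < α) (hε : 0 < ε)
    (x : EuclideanSpace ℝ (Fin n)) : 0 < barrierSlope c α ε x := by
  unfold barrierSlope; positivity

theorem hasFDerivAt_exp_neg_norm_sq (c : EuclideanSpace ℝ (Fin n)) (α : ℝ)
    (x : EuclideanSpace ℝ (Fin n)) :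
    HasFDerivAt (fun x => Real.exp (-α * ‖x - c‖ ^ 2))
      ((-(2 * α * Real.exp (-α * ‖x - c‖ ^ 2))) • innerSL ℝ (x - c)) x := by
  have h1 : HasFDerivAt (fun x => ‖x - c‖ ^ 2) (2 • innerSL ℝ (x - c)) x := by
    simpa using! (hasFDerivAt_id x).sub_const c |>.norm_sq
  refine (h1.const_mul (-α)).exp.congr_fderiv ?_
  module

theorem contDiff_barrierSlope (c : EuclideanSpace ℝ (Fin n)) (α ε : ℝ) :
    ContDiff ℝ 2 (barrierSlope c α ε) := by
  unfold barrierSlope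
  exact contDiff_const.mul
    (contDiff_const.mul ((contDiff_id.sub contDiff_const).norm_sq ℝ)).exp

theorem contDiff_barrier (c : EuclideanSpace ℝ (Fin n)) (r α ε : ℝ) :
    ContDiff ℝ 2 (barrier c r α ε) := by
  unfold barrier
  exact contDiff_const.mul ((contDiff_const.mul
    ((contDiff_id.sub contDiff_const).norm_sq ℝ)).exp.sub contDiff_const)

theorem gradient_barrier (c : EuclideanSpace ℝ (Fin n)) (r α ε : ℝ)
    (x : EuclideanSpace ℝ (Fin n)) :
    gradient (barrier c r α ε) x = -(barrierSlope c α ε x • (x - c)) := by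
  refine ext_inner_right ℝ fun v => ?_
  have h := ((hasFDerivAt_exp_neg_norm_sq c α x).sub_const (Real.exp (-α * r ^ 2))).const_mul ε
  rw [inner_gradient_left]
  unfold barrier
  rw [h.fderiv]
  simp [barrierSlope, inner_sub_left, real_inner_smul_left]
  ring

/-- The flux of the barrier, in terms of the `0`-homogeneous odd field `∇H`. -/
theorem inner_flux_gradient_barrier (hH : AdmissibleH β H) (c : EuclideanSpace ℝ (Fin n))
    (r : ℝ) {α ε : ℝ} (hα : 0 < α) (hε : 0 < ε) (x v : EuclideanSpace ℝ (Fin n)) :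
    inner ℝ (flux B H (gradient (barrier c r α ε) x)) v =
      -(dB B (barrierSlope c α ε x * H (x - c)) * fderiv ℝ H (x - c) v) := by
  have hm := barrierSlope_pos c hα hε x
  rw [gradient_barrier, inner_flux, hH.even, hH.fderiv_neg, hH.smul _ hm, hH.fderiv_smul _ hm]
  simp

theorem contDiffAt_barrier_flux (hB : AdmissibleB β B) (hH : AdmissibleH β H)
    (c : EuclideanSpace ℝ (Fin n)) {α ε : ℝ} (hα : 0 < α) (hε : 0 < ε)
    {x : EuclideanSpace ℝ (Fin n)} (hx : x ≠ c) (v : EuclideanSpace ℝ (Fin n)) :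
    ContDiffAt ℝ 1
      (fun x => dB B (barrierSlope c α ε x * H (x - c)) * fderiv ℝ H (x - c) v) x := by
  have hz : x - c ≠ 0 := sub_ne_zero.2 hx
  have hsub : ContDiffAt ℝ 1 (fun x => x - c) x := contDiffAt_id.sub contDiffAt_const
  have h1 : ContDiffAt ℝ 1 (fun x => H (x - c)) x :=
    ((hH.contDiffAt hz).of_le (by norm_num)).comp x hsub
  have h2 : ContDiffAt ℝ 1 (fun x => fderiv ℝ H (x - c)) x :=
    ((hH.contDiffAt_fderiv hz).of_le (by norm_num)).comp x hsub
  have h3 : ContDiffAt ℝ 1 (fun x => barrierSlope c α ε x * H (x - c)) x :=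
    ((contDiff_barrierSlope c α ε).contDiffAt.of_le (by norm_num)).mul h1
  have hpos : 0 < barrierSlope c α ε x * H (x - c) :=
    mul_pos (barrierSlope_pos c hα hε x) (hH.pos _ hz)
  exact (((hB.contDiffAt_dB hpos).of_le (by norm_num)).comp x h3).mul
    (h2.clm_apply contDiffAt_const)

theorem fderiv_barrier_flux (hB : AdmissibleB β B) (hH : AdmissibleH β H)
    (c : EuclideanSpace ℝ (Fin n)) {α ε : ℝ} (hα : 0 < α) (hε : 0 < ε)
    {x : EuclideanSpace ℝ (Fin n)} (hx : x ≠ c) (v : EuclideanSpace ℝ (Fin n)) :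
    fderiv ℝ
      (fun x => dB B (barrierSlope c α ε x * H (x - c)) * fderiv ℝ H (x - c) v) x v =
    deriv (dB B) (barrierSlope c α ε x * H (x - c)) * barrierSlope c α ε x *
        (fderiv ℝ H (x - c) v ^ 2 -
          2 * α * H (x - c) * (inner ℝ (x - c) v * fderiv ℝ H (x - c) v)) +
      dB B (barrierSlope c α ε x * H (x - c)) * fderiv ℝ (fderiv ℝ H) (x - c) v v := by
  have hz : x - c ≠ 0 := sub_ne_zero.2 hx
  have hpos : 0 < barrierSlope c α ε x * H (x - c) :=
    mul_pos (barrierSlope_pos c hα hε x) (hH.pos _ hz)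
  have h1 : HasFDerivAt (fun x => H (x - c)) (fderiv ℝ H (x - c)) x :=
    (hasFDerivAt_comp_sub c).2 (hH.differentiableAt hz).hasFDerivAt
  have h2 : HasFDerivAt (fun x => fderiv ℝ H (x - c)) (fderiv ℝ (fderiv ℝ H) (x - c)) x :=
    (hasFDerivAt_comp_sub c).2 (hH.differentiableAt_fderiv hz).hasFDerivAt
  have h3 : HasFDerivAt (barrierSlope c α ε) _ x :=
    (hasFDerivAt_exp_neg_norm_sq c α x).const_mul (2 * α * ε)
  have h4 := (hB.differentiableAt_dB hpos).hasDerivAt.comp_hasFDerivAt x (h3.mul h1)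
  have h5 := h4.mul (h2.clm_apply (hasFDerivAt_const v x))
  have h6 := h5.fderiv
  refine (congrArg (fun L => L v) h6).trans ?_
  simp [barrierSlope, inner_sub_left]
  ring

/-- Minus the divergence of the flux of the barrier. -/
theorem sum_fderiv_barrier_flux (hB : AdmissibleB β B) (hH : AdmissibleH β H)
    (c : EuclideanSpace ℝ (Fin n)) {α ε : ℝ} (hα : 0 < α) (hε : 0 < ε)
    {x : EuclideanSpace ℝ (Fin n)} (hx : x ≠ c)
    (b : OrthonormalBasis (Fin n) ℝ (EuclideanSpace ℝ (Fin n))) :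
    ∑ i, fderiv ℝ
      (fun x => dB B (barrierSlope c α ε x * H (x - c)) * fderiv ℝ H (x - c) (b i)) x (b i) =
    deriv (dB B) (barrierSlope c α ε x * H (x - c)) * barrierSlope c α ε x *
        (∑ i, fderiv ℝ H (x - c) (b i) ^ 2 - 2 * α * H (x - c) ^ 2) +
      dB B (barrierSlope c α ε x * H (x - c)) *
        ∑ i, fderiv ℝ (fderiv ℝ H) (x - c) (b i) (b i) := by
  have hz : x - c ≠ 0 := sub_ne_zero.2 hx
  -- Parseval and Euler's identity: this yields the negative term `-2 α H²`.
  have hE : ∑ i, inner ℝ (x - c) (b i) * fderiv ℝ H (x - c) (b i) = H (x - c) := by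
    simp_rw [← inner_gradient_left (𝕜 := ℝ) (f := H), real_inner_comm (b _) (gradient H (x - c))]
    rw [b.sum_inner_mul_inner, real_inner_comm, inner_gradient_left, hH.fderiv_self hz]
  simp_rw [fderiv_barrier_flux hB hH c hα hε hx, Finset.sum_add_distrib, ← Finset.mul_sum,
    Finset.sum_sub_distrib, ← Finset.mul_sum, hE]
  ring

/-- For `α` large, the barriers are strict subsolutions in an annulus around `c`. -/
theorem exists_sum_fderiv_barrier_flux_neg (hB : AdmissibleB β B) (hH : AdmissibleH β H)
    (c : EuclideanSpace ℝ (Fin n)) {r₀ r : ℝ} (hr₀ : 0 < r₀)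
    (b : OrthonormalBasis (Fin n) ℝ (EuclideanSpace ℝ (Fin n))) :
    ∃ α : ℝ, 0 < α ∧ ∀ ε : ℝ, 0 < ε → ∀ x, r₀ ≤ ‖x - c‖ → ‖x - c‖ ≤ r →
      ∑ i, fderiv ℝ
        (fun x => dB B (barrierSlope c α ε x * H (x - c)) * fderiv ℝ H (x - c) (b i)) x (b i)
        < 0 := by
  obtain ⟨K, hK, hKB⟩ := hB.exists_dB_le
  set A : Set (EuclideanSpace ℝ (Fin n)) := {z | r₀ ≤ ‖z‖} ∩ Metric.closedBall 0 r with hA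
  have hAc : IsCompact A :=
    (isCompact_closedBall 0 r).inter_left (isClosed_le continuous_const continuous_norm)
  have hA0 : ∀ z ∈ A, z ≠ 0 := by
    rintro z ⟨hz, -⟩ rfl
    simp at hz; linarith
  have hc2 : ContinuousOn
      (fun z => (∑ i, fderiv ℝ H z (b i) ^ 2 +
        K * H z * |∑ i, fderiv ℝ (fderiv ℝ H) z (b i) (b i)|) / H z ^ 2) A := by
    intro z hz
    have h0 := hA0 z hz
    have e1 : ContinuousAt H z := (hH.differentiableAt h0).continuousAt
    have e2 : ContinuousAt (fderiv ℝ H) z := (hH.contDiffAt_fderiv h0).continuousAt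
    have e3 : ContinuousAt (fderiv ℝ (fderiv ℝ H)) z :=
      ((hH.contDiffAt_fderiv h0).fderiv_right (m := 1) (by norm_num)).continuousAt
    have e4 : H z ^ 2 ≠ 0 := (pow_pos (hH.pos z h0) 2).ne'
    refine ContinuousAt.continuousWithinAt (ContinuousAt.div ?_ (e1.pow 2) e4)
    have e5 : ∀ v, ContinuousAt (fun z => fderiv ℝ H z v) z :=
      fun v => e2.clm_apply continuousAt_const
    have e6 : ∀ v, ContinuousAt (fun z => fderiv ℝ (fderiv ℝ H) z v v) z :=
      fun v => (e3.clm_apply continuousAt_const).clm_apply continuousAt_const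
    fun_prop
  obtain ⟨M, hM⟩ := hAc.bddAbove_image hc2
  -- `M` bounds, on the compact annulus, the quotient of the unfavourable terms by `H²`; any `α > 0`
  -- with `2 α > M` would do.
  refine ⟨|M| + 1, by positivity, fun ε hε x hx0 hxr => ?_⟩
  set α := |M| + 1 with hαdef
  have hα : 0 < α := by positivity
  have hxA : x - c ∈ A := ⟨hx0, by simpa using hxr⟩
  have hz := hA0 _ hxA
  rw [sum_fderiv_barrier_flux hB hH c hα hε (sub_ne_zero.1 hz) b]
  have hm := barrierSlope_pos c hα hε x
  set m := barrierSlope c α ε x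
  have hHz := hH.pos _ hz
  have hMz : (∑ i, fderiv ℝ H (x - c) (b i) ^ 2 +
        K * H (x - c) * |∑ i, fderiv ℝ (fderiv ℝ H) (x - c) (b i) (b i)|) / H (x - c) ^ 2 ≤ M :=
    hM ⟨_, hxA, rfl⟩
  rw [div_le_iff₀ (by positivity)] at hMz
  set h := H (x - c)
  set q := ∑ i, fderiv ℝ H (x - c) (b i) ^ 2
  set l := ∑ i, fderiv ℝ (fderiv ℝ H) (x - c) (b i) (b i)
  have hmh : 0 < m * h := by positivity
  have h1 : dB B (m * h) * l ≤ K * (m * h * deriv (dB B) (m * h)) * |l| :=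
    (mul_le_mul_of_nonneg_left (le_abs_self l) (hB.dB_nonneg hmh.le)).trans
      (mul_le_mul_of_nonneg_right (hKB _ hmh) (abs_nonneg l))
  have hD := (hB.pos _ hmh).2.2
  set D := deriv (dB B) (m * h)
  have h2 : q - 2 * α * h ^ 2 + K * h * |l| < 0 := by
    have : M < 2 * α := by linarith [le_abs_self M, abs_nonneg M]
    nlinarith [mul_lt_mul_of_pos_right this (pow_pos hHz 2)]
  -- By `h1`, the whole divergence is at most `D m` times the bracket in `h2`; `ε` enters only
  -- through the positive factor `D m`.
  have h3 := mul_neg_of_pos_of_neg (mul_pos hD hm) h2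
  nlinarith

end Barrier

/-! ### Weak comparison with the barrier. -/

section Comparison

variable {n : ℕ} {β : ℝ≥0} {B : ℝ → ℝ} {H : EuclideanSpace ℝ (Fin n) → ℝ}

/-- Continuity is asked on `K` only: the barrier field may be singular at `c`, and `∇u` is
controlled only inside `Ω`. -/
theorem integrable_of_continuousOn_of_eq_zero {K : Set (EuclideanSpace ℝ (Fin n))}
    (hK : IsCompact K) {g : EuclideanSpace ℝ (Fin n) → ℝ} (hg : ContinuousOn g K)
    (h0 : ∀ x ∉ K, g x = 0) : Integrable g :=
  (integrableOn_iff_integrable_of_support_subset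
    (Function.support_subset_iff'.2 h0)).1 (hg.integrableOn_compact hK)

/-- Squaring removes the corner of the positive part, so that truncations are `C¹`, as the test
functions must be. -/
theorem hasDerivAt_max_sub_sq (a s : ℝ) :
    HasDerivAt (fun s : ℝ => max (s - a) 0 ^ 2) (2 * max (s - a) 0) s := by
  rcases lt_trichotomy s a with h | rfl | h
  · have : (fun s : ℝ => max (s - a) 0 ^ 2) =ᶠ[𝓝 s] fun _ => 0 := by
      filter_upwards [Iio_mem_nhds h] with t ht
      rw [max_eq_right (by linarith [mem_Iio.1 ht])]; norm_num
    rw [max_eq_right (by linarith), mul_zero]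
    exact (hasDerivAt_const s (0 : ℝ)).congr_of_eventuallyEq this
  · rw [sub_self, max_self, mul_zero, hasDerivAt_iff_isLittleO]
    have h1 : (fun x : ℝ => max (x - s) 0 ^ 2) =O[𝓝 s] fun x => (x - s) ^ 2 := by
      refine Asymptotics.IsBigO.of_bound 1 (Eventually.of_forall fun x => ?_)
      rw [one_mul, norm_pow, norm_pow]
      refine pow_le_pow_left₀ (norm_nonneg _) ?_ 2
      rw [Real.norm_eq_abs, Real.norm_eq_abs, abs_of_nonneg (le_max_right _ _)]
      exact max_le (le_abs_self _) (abs_nonneg _)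
    have h2 : (fun x : ℝ => (x - s) ^ 2) =o[𝓝 s] fun x => x - s := by
      have := (Asymptotics.isLittleO_pow_id (𝕜 := ℝ) (n := 2) (by norm_num)).comp_tendsto
        (show Tendsto (fun x : ℝ => x - s) (𝓝 s) (𝓝 0) by
          simpa using (continuous_id.sub continuous_const).tendsto (f := fun x : ℝ => x - s) s)
      simpa [Function.comp_def] using this
    simpa using h1.trans_isLittleO h2
  · have : (fun s : ℝ => max (s - a) 0 ^ 2) =ᶠ[𝓝 s] fun s => (s - a) ^ 2 := by
      filter_upwards [Ioi_mem_nhds h] with t ht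
      rw [max_eq_left (by linarith [mem_Ioi.1 ht])]
    rw [max_eq_left (by linarith)]
    have h2 := ((hasDerivAt_id s).sub_const a).pow 2
    simp only [id, Nat.cast_ofNat, Nat.add_one_sub_one, pow_one, mul_one] at h2
    exact HasDerivAt.congr_of_eventuallyEq h2 this

/-- Truncating `w` at a positive level gives an admissible test function, if `w ≤ 0` on the
boundary of `U`. -/
theorem exists_testFunction {U : Set (EuclideanSpace ℝ (Fin n))} (hU : IsOpen U)
    (hUb : Bornology.IsBounded U) {w : EuclideanSpace ℝ (Fin n) → ℝ}
    {Dw : EuclideanSpace ℝ (Fin n) → EuclideanSpace ℝ (Fin n)}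
    (hw : ContinuousOn w (closure U)) (hDw : ContinuousOn Dw U)
    (hgrad : ∀ x ∈ U, HasGradientAt w (Dw x) x) (hbd : ∀ x ∈ frontier U, w x ≤ 0)
    {x₀ : EuclideanSpace ℝ (Fin n)} (hx₀ : x₀ ∈ U) (hwx₀ : 0 < w x₀) :
    ∃ (ψ : EuclideanSpace ℝ (Fin n) → ℝ) (ρ : EuclideanSpace ℝ (Fin n) → ℝ),
      ContDiff ℝ 1 ψ ∧ HasCompactSupport ψ ∧ tsupport ψ ⊆ U ∧ (∀ x, 0 ≤ ψ x) ∧ ψ x₀ ≠ 0 ∧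
      (∀ x, 0 ≤ ρ x) ∧ ∀ x, gradient ψ x = ρ x • Dw x := by
  -- Truncating at a level strictly between `0` and `w x₀` keeps the support away from the boundary,
  -- where `w ≤ 0`, and keeps `x₀` in it.
  set a := w x₀ / 2 with ha
  have hapos : 0 < a := by positivity
  set K := closure U ∩ w ⁻¹' Ici a with hKdef
  have hKclosed : IsClosed K := hw.preimage_isClosed_of_isClosed isClosed_closure isClosed_Ici
  have hKc : IsCompact K :=
    hUb.isCompact_closure.of_isClosed_subset hKclosed inter_subset_left
  have hKU : K ⊆ U := by
    rintro x ⟨hx, hxa⟩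
    by_contra hxU
    have := hbd x (by rw [hU.frontier_eq]; exact ⟨hx, hxU⟩)
    have h2 : a ≤ w x := hxa
    linarith
  set ψ := U.indicator fun x => max (w x - a) 0 ^ 2 with hψ
  set ρ := U.indicator fun x => 2 * max (w x - a) 0 with hρ
  have hsmall : ∀ x ∈ U, x ∉ K → max (w x - a) 0 = 0 := by
    intro x hx hxK
    refine max_eq_right ?_
    by_contra h
    exact hxK ⟨subset_closure hx, by simp only [mem_preimage, mem_Ici]; linarith⟩
  have hψ0 : ∀ x ∉ K, ψ x = 0 := by
    intro x hxK
    by_cases hx : x ∈ U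
    · simp [hψ, hx, hsmall x hx hxK]
    · simp [hψ, hx]
  have hρ0 : ∀ x ∉ K, ρ x = 0 := by
    intro x hxK
    by_cases hx : x ∈ U
    · simp [hρ, hx, hsmall x hx hxK]
    · simp [hρ, hx]
  have hts : tsupport ψ ⊆ K :=
    closure_minimal (Function.support_subset_iff'.2 hψ0) hKclosed
  have hgψ : ∀ x, HasGradientAt ψ (ρ x • Dw x) x := by
    intro x
    by_cases hx : x ∈ U
    · have h1 := (hasDerivAt_max_sub_sq a (w x)).comp_hasFDerivAt x (hgrad x hx).hasFDerivAt
      have h2 : ψ =ᶠ[𝓝 x] (fun s : ℝ => max (s - a) 0 ^ 2) ∘ w := by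
        filter_upwards [hU.mem_nhds hx] with z hz
        simp [hψ, hz]
      rw [hasGradientAt_iff_hasFDerivAt]
      refine (h1.congr_of_eventuallyEq h2).congr_fderiv ?_
      simp [hρ, hx]
    · have hxK : x ∉ K := fun h => hx (hKU h)
      have h2 : ψ =ᶠ[𝓝 x] fun _ => 0 := by
        filter_upwards [hKclosed.isOpen_compl.mem_nhds hxK] with z hz using hψ0 z hz
      rw [hρ0 x hxK, zero_smul]
      exact (hasGradientAt_const x (0 : ℝ)).congr_of_eventuallyEq h2
  have hcont : Continuous fun x => ρ x • Dw x := by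
    refine continuous_iff_continuousAt.2 fun x => ?_
    by_cases hx : x ∈ U
    · have hw' : ContinuousAt w x := (hgrad x hx).differentiableAt.continuousAt
      have hD' : ContinuousAt Dw x := hDw.continuousAt (hU.mem_nhds hx)
      have h1 : ContinuousAt (fun x => (2 * max (w x - a) 0) • Dw x) x := by fun_prop
      refine h1.congr ?_
      filter_upwards [hU.mem_nhds hx] with z hz
      simp [hρ, hz]
    · have hxK : x ∉ K := fun h => hx (hKU h)
      refine (continuousAt_const (y := (0 : EuclideanSpace ℝ (Fin n)))).congr ?_
      filter_upwards [hKclosed.isOpen_compl.mem_nhds hxK] with z hz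
      rw [hρ0 z hz, zero_smul]
  refine ⟨ψ, ρ, ?_, hKc.of_isClosed_subset (isClosed_tsupport _) hts, hts.trans hKU, ?_, ?_, ?_,
    fun x => (hgψ x).gradient⟩
  · refine contDiff_one_iff_fderiv.2 ⟨fun x => (hgψ x).differentiableAt, ?_⟩
    have : fderiv ℝ ψ = fun x => InnerProductSpace.toDual ℝ _ (ρ x • Dw x) := by
      ext1 x; exact (hgψ x).hasFDerivAt.fderiv
    rw [this]
    exact (InnerProductSpace.toDual ℝ _).continuous.comp hcont
  · exact fun x => indicator_nonneg (fun z _ => by positivity) x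
  · have : w x₀ - a = a := by rw [ha]; ring
    simp [hψ, hx₀, this, hapos.le, hapos.ne']
  · exact fun x => indicator_nonneg (fun z _ => by positivity) x

/-- A strict subsolution tested against a nonnegative function. -/
theorem integral_inner_flux_barrier_neg (hB : AdmissibleB β B) (hH : AdmissibleH β H)
    {c : EuclideanSpace ℝ (Fin n)} {r α ε : ℝ} (hα : 0 < α) (hε : 0 < ε)
    (b : OrthonormalBasis (Fin n) ℝ (EuclideanSpace ℝ (Fin n)))
    {U : Set (EuclideanSpace ℝ (Fin n))} (hcU : c ∉ U)
    (hsub : ∀ x ∈ U, ∑ i, fderiv ℝ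
      (fun x => dB B (barrierSlope c α ε x * H (x - c)) * fderiv ℝ H (x - c) (b i)) x (b i) < 0)
    {ψ : EuclideanSpace ℝ (Fin n) → ℝ} (hψ : ContDiff ℝ 1 ψ) (hψc : HasCompactSupport ψ)
    (hψU : tsupport ψ ⊆ U) (hψ0 : ∀ x, 0 ≤ ψ x) {x₀ : EuclideanSpace ℝ (Fin n)}
    (hx₀ : ψ x₀ ≠ 0) :
    ∫ x, inner ℝ (flux B H (gradient (barrier c r α ε) x)) (gradient ψ x) < 0 := by
  set P : Fin n → EuclideanSpace ℝ (Fin n) → ℝ := fun i x =>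
    dB B (barrierSlope c α ε x * H (x - c)) * fderiv ℝ H (x - c) (b i) with hP
  have hne : ∀ x ∈ tsupport ψ, x ≠ c := by
    rintro x hx rfl; exact hcU (hψU hx)
  have hPc : ∀ i, ∀ x ∈ tsupport ψ, ContDiffAt ℝ 1 (P i) x := fun i x hx =>
    contDiffAt_barrier_flux hB hH c hα hε (hne x hx) (b i)
  have hK : IsCompact (tsupport ψ) := hψc
  have hψz : ∀ x ∉ tsupport ψ, ψ x = 0 := fun x hx => image_eq_zero_of_notMem_tsupport hx
  have hdψz : ∀ x ∉ tsupport ψ, fderiv ℝ ψ x = 0 := fun x hx =>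
    image_eq_zero_of_notMem_tsupport fun h => hx (tsupport_fderiv_subset ℝ h)
  have hdψ : Continuous (fderiv ℝ ψ) := hψ.continuous_fderiv (by norm_num)
  have hi1 : ∀ i, Integrable fun x => fderiv ℝ (P i) x (b i) * ψ x := by
    intro i
    refine integrable_of_continuousOn_of_eq_zero hK (fun x hx => ?_)
      fun x hx => by rw [hψz x hx, mul_zero]
    have h1 : ContinuousAt (fderiv ℝ (P i)) x :=
      ((hPc i x hx).fderiv_right (m := 0) (by norm_num)).continuousAt
    exact ((h1.clm_apply continuousAt_const).mul
      hψ.continuous.continuousAt).continuousWithinAt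
  have hi2 : ∀ i, Integrable fun x => P i x * fderiv ℝ ψ x (b i) := by
    intro i
    refine integrable_of_continuousOn_of_eq_zero hK (fun x hx => ?_)
      fun x hx => by rw [hdψz x hx]; simp
    exact ((hPc i x hx).continuousAt.mul
      (hdψ.clm_apply continuous_const).continuousAt).continuousWithinAt
  have hi3 : ∀ i, Integrable fun x => P i x * ψ x := by
    intro i
    refine integrable_of_continuousOn_of_eq_zero hK (fun x hx => ?_)
      fun x hx => by rw [hψz x hx, mul_zero]
    exact ((hPc i x hx).continuousAt.mul hψ.continuous.continuousAt).continuousWithinAt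
  have hparts : ∀ i, ∫ x, P i x * fderiv ℝ ψ x (b i) = -∫ x, fderiv ℝ (P i) x (b i) * ψ x :=
    fun i => integral_mul_fderiv_eq_neg_fderiv_mul_of_integrable (hi1 i) (hi2 i) (hi3 i)
      (fun x hx => (hPc i x hx).differentiableAt (by norm_num))
      fun x _ => (hψ.differentiable (by norm_num)).differentiableAt
  have hexp : ∀ x, inner ℝ (flux B H (gradient (barrier c r α ε) x)) (gradient ψ x) =
      -∑ i, P i x * fderiv ℝ ψ x (b i) := by
    intro x
    rw [← b.sum_inner_mul_inner, ← Finset.sum_neg_distrib]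
    refine Finset.sum_congr rfl fun i _ => ?_
    rw [inner_flux_gradient_barrier hH c r hα hε, real_inner_comm, inner_gradient_left]
    ring
  have hS : ∫ x, inner ℝ (flux B H (gradient (barrier c r α ε) x)) (gradient ψ x) =
      -∫ x, -(∑ i, fderiv ℝ (P i) x (b i)) * ψ x := by
    simp_rw [hexp, neg_mul, Finset.sum_mul, integral_neg]
    rw [integral_finsetSum _ fun i _ => hi2 i, integral_finsetSum _ fun i _ => hi1 i]
    simp [hparts]
  have hint : Integrable fun x => -(∑ i, fderiv ℝ (P i) x (b i)) * ψ x := by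
    simp_rw [neg_mul, Finset.sum_mul]
    exact (integrable_finsetSum _ fun i _ => hi1 i).neg
  have hnn : ∀ x, 0 ≤ -(∑ i, fderiv ℝ (P i) x (b i)) * ψ x := by
    intro x
    by_cases hx : x ∈ tsupport ψ
    · exact mul_nonneg (by linarith [hsub x (hψU hx)]) (hψ0 x)
    · rw [hψz x hx, mul_zero]
  -- The integrand is positive wherever `ψ ≠ 0`, a nonempty open set, hence of positive measure.
  rw [hS, neg_lt_zero, integral_pos_iff_support_of_nonneg hnn hint]
  refine lt_of_lt_of_le ((hψ.continuous.isOpen_support).measure_pos volume ⟨x₀, hx₀⟩)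
    (measure_mono fun x hx => ?_)
  have hx' := hsub x (hψU (subset_tsupport ψ hx))
  exact mul_ne_zero (by linarith) hx

/-- Comparison of a supersolution with the barrier. -/
theorem barrier_le (hB : AdmissibleB β B) (hH : AdmissibleH β H)
    {c : EuclideanSpace ℝ (Fin n)} {r α ε : ℝ} (hα : 0 < α) (hε : 0 < ε)
    (b : OrthonormalBasis (Fin n) ℝ (EuclideanSpace ℝ (Fin n)))
    {Ω U : Set (EuclideanSpace ℝ (Fin n))} (hΩ : IsOpen Ω) (hU : IsOpen U) (hUΩ : U ⊆ Ω)
    (hUb : Bornology.IsBounded U) (hcU : c ∉ U)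
    (hsub : ∀ x ∈ U, ∑ i, fderiv ℝ
      (fun x => dB B (barrierSlope c α ε x * H (x - c)) * fderiv ℝ H (x - c) (b i)) x (b i) < 0)
    {f : ℝ → ℝ} {u : EuclideanSpace ℝ (Fin n) → ℝ} (hu : IsC1Closure Ω u)
    (husol : IsWeakSolution B H f Ω u) (hfu : ∀ x ∈ Ω, 0 ≤ f (u x))
    (hbd : ∀ x ∈ frontier U, barrier c r α ε x ≤ u x) :
    ∀ x ∈ U, barrier c r α ε x ≤ u x := by
  by_contra! hcon
  obtain ⟨x₀, hx₀, hlt⟩ := hcon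
  obtain ⟨huc, Du, hDuc, hDu⟩ := hu
  have hv := contDiff_barrier c r α ε
  have hvd : Differentiable ℝ (barrier c r α ε) := hv.differentiable (by norm_num)
  have hvc : Continuous (gradient (barrier c r α ε)) :=
    (InnerProductSpace.toDual ℝ _).symm.continuous.comp (hv.continuous_fderiv (by norm_num))
  have hDuU : ContinuousOn Du U := hDuc.mono (hUΩ.trans subset_closure)
  obtain ⟨ψ, ρ, hψ, hψc, hψU, hψ0, hψx₀, hρ, hgψ⟩ := exists_testFunction hU hUb
    (w := fun x => barrier c r α ε x - u x) (Dw := fun x => gradient (barrier c r α ε) x - Du x)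
    (hv.continuous.continuousOn.sub (huc.mono (closure_mono hUΩ)))
    (hvc.continuousOn.sub hDuU)
    (fun x hx => by
      rw [hasGradientAt_iff_hasFDerivAt, map_sub]
      exact (hvd x).hasGradientAt.hasFDerivAt.sub (hDu x (hUΩ hx)).hasFDerivAt)
    (fun x hx => sub_nonpos.2 (hbd x hx)) hx₀ (sub_pos.2 hlt)
  have hgz : ∀ x ∉ tsupport ψ, gradient ψ x = 0 := by
    intro x hx
    have : fderiv ℝ ψ x = 0 :=
      image_eq_zero_of_notMem_tsupport fun h => hx (tsupport_fderiv_subset ℝ h)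
    simp [gradient, this]
  have hgψc : Continuous (gradient ψ) :=
    (InnerProductSpace.toDual ℝ _).symm.continuous.comp (hψ.continuous_fderiv (by norm_num))
  have hneg := integral_inner_flux_barrier_neg (r := r) hB hH hα hε b hcU hsub hψ hψc hψU hψ0
    hψx₀
  have hpos : 0 ≤ ∫ x, inner ℝ (flux B H (gradient u x)) (gradient ψ x) := by
    have h1 := husol ψ hψ hψc (hψU.trans hUΩ)
    have h2 : 0 ≤ ∫ x in Ω, f (u x) * ψ x :=
      setIntegral_nonneg hΩ.measurableSet fun x hx => mul_nonneg (hfu x hx) (hψ0 x)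
    rw [← h1] at h2
    simp_rw [flux, real_inner_smul_left]
    rwa [← setIntegral_eq_integral_of_forall_compl_eq_zero (s := Ω)]
    intro x hx
    rw [hgz x fun h => hx (hUΩ (hψU h)), inner_zero_right, mul_zero]
  have hi1 : Integrable fun x =>
      inner ℝ (flux B H (gradient (barrier c r α ε) x)) (gradient ψ x) :=
    integrable_of_continuousOn_of_eq_zero hψc
      (((continuous_flux hB hH).comp hvc).inner hgψc).continuousOn
      fun x hx => by rw [hgz x hx, inner_zero_right]
  have hgu : ContinuousOn (gradient u) (tsupport ψ) :=
    (hDuU.mono hψU).congr fun x hx => (hDu x (hUΩ (hψU hx))).gradient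
  have hi2 : Integrable fun x => inner ℝ (flux B H (gradient u x)) (gradient ψ x) :=
    integrable_of_continuousOn_of_eq_zero hψc
      (((continuous_flux hB hH).comp_continuousOn hgu).inner hgψc.continuousOn)
      fun x hx => by rw [hgz x hx, inner_zero_right]
  have hmono : 0 ≤ ∫ x, (inner ℝ (flux B H (gradient (barrier c r α ε) x)) (gradient ψ x) -
      inner ℝ (flux B H (gradient u x)) (gradient ψ x)) := by
    refine integral_nonneg fun x => ?_
    by_cases hx : x ∈ tsupport ψ
    · simp only [Pi.zero_apply]
      -- `∇ψ` is a nonnegative multiple of `∇v - ∇u`, exactly the direction in which the flux is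
      -- monotone.
      rw [← inner_sub_left, hgψ, real_inner_smul_right, ← (hDu x (hUΩ (hψU hx))).gradient]
      exact mul_nonneg (hρ x) (flux_monotone hB hH _ _)
    · simp [hgz x hx]
  rw [integral_sub hi1 hi2] at hmono
  linarith

end Comparison

/-! ### Normal derivatives and interior spheres. -/

section Hopf

variable {n : ℕ} {β : ℝ≥0} {B f : ℝ → ℝ} {H u : EuclideanSpace ℝ (Fin n) → ℝ}
  {Ω : Set (EuclideanSpace ℝ (Fin n))} {y ν : EuclideanSpace ℝ (Fin n)} {R : ℝ}

theorem norm_add_smul_sub_add_smul (hν : ‖ν‖ = 1) (t : ℝ) :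
    ‖y + t • ν - (y + R • ν)‖ = |t - R| := by
  rw [add_sub_add_left_eq_sub, ← sub_smul, norm_smul, hν, mul_one, Real.norm_eq_abs]

theorem IsInteriorSphere.add_smul_mem (hS : IsInteriorSphere Ω y ν R) {t : ℝ}
    (ht : t ∈ Ioo 0 R) : y + t • ν ∈ Ω := by
  refine hS.2.2 ?_
  rw [mem_ball_iff_norm, norm_add_smul_sub_add_smul hS.2.1, abs_lt]
  constructor <;> linarith [ht.1, ht.2]

/-- A function in `C¹(closure Ω)` has one-sided derivatives along the normal of an interior
sphere. -/
theorem IsC1Closure.hasDerivWithinAt (hu : IsC1Closure Ω u) (hy : y ∈ closure Ω)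
    (hS : IsInteriorSphere Ω y ν R) :
    ∃ d : ℝ, HasDerivWithinAt (fun t : ℝ => u (y + t • ν)) d (Ici 0) 0 := by
  obtain ⟨huc, Du, hDuc, hDu⟩ := hu
  have hline : Continuous fun t : ℝ => y + t • ν := by fun_prop
  have hmaps : MapsTo (fun t : ℝ => y + t • ν) (Ioo 0 R) (closure Ω) :=
    fun t ht => subset_closure (hS.add_smul_mem ht)
  have h0 : y + (0 : ℝ) • ν = y := by simp
  have hderiv : ∀ t ∈ Ioo 0 R,
      HasDerivAt (fun t : ℝ => u (y + t • ν)) (inner ℝ (Du (y + t • ν)) ν) t := by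
    intro t ht
    have h1 : HasDerivAt (fun t : ℝ => y + t • ν) ν t := by
      simpa using ((hasDerivAt_id t).smul_const ν).const_add y
    exact (hDu _ (hS.add_smul_mem ht)).hasFDerivAt.comp_hasDerivAt t h1
  have hR : Ioo 0 R ∈ 𝓝[>] (0 : ℝ) := Ioo_mem_nhdsGT hS.1
  -- The derivative along the normal has a limit at `0`, since `Du` is continuous up to `y`; that
  -- limit is the one-sided derivative.
  refine ⟨inner ℝ (Du y) ν, hasDerivWithinAt_Ici_of_tendsto_deriv (s := Ioo 0 R)
    (fun t ht => (hderiv t ht).differentiableAt.differentiableWithinAt) ?_ hR ?_⟩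
  · exact ContinuousWithinAt.comp (t := closure Ω) (by rw [h0]; exact huc y hy)
      hline.continuousWithinAt hmaps
  · have h1 : ContinuousWithinAt (fun t : ℝ => inner ℝ (Du (y + t • ν)) ν) (Ioo 0 R) 0 :=
      (ContinuousWithinAt.comp (t := closure Ω) (by rw [h0]; exact hDuc y hy)
        hline.continuousWithinAt hmaps).inner continuousWithinAt_const
    have h2 : Tendsto (fun t : ℝ => inner ℝ (Du (y + t • ν)) ν) (𝓝[>] 0)
        (𝓝 (inner ℝ (Du y) ν)) := by
      have := h1.tendsto
      rw [h0] at this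
      exact this.mono_left (nhdsWithin_le_iff.2 hR)
    refine h2.congr' ?_
    filter_upwards [hR] with t ht using (hderiv t ht).deriv.symm

theorem le_of_hasDerivWithinAt_Ici {φ χ : ℝ → ℝ} {φ' χ' : ℝ}
    (hφ : HasDerivWithinAt φ φ' (Ici 0) 0) (hχ : HasDerivWithinAt χ χ' (Ici 0) 0)
    (h0 : φ 0 = χ 0) (hle : ∀ᶠ t in 𝓝[>] 0, φ t ≤ χ t) : φ' ≤ χ' := by
  have h1 := hasDerivWithinAt_iff_tendsto_slope.1 hφ
  have h2 := hasDerivWithinAt_iff_tendsto_slope.1 hχ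
  rw [Ici_sdiff_left] at h1 h2
  refine le_of_tendsto_of_tendsto h1 h2 ?_
  filter_upwards [hle, self_mem_nhdsWithin] with t ht ht0
  have ht0' : (0 : ℝ) < t := ht0
  simp only [slope_def_field, sub_zero, h0]
  gcongr

theorem hasPosDirDeriv_of_isInteriorSphere (hΩ : IsOpen Ω) (hB : AdmissibleB β B)
    (hH : AdmissibleH β H) (hf : AdmissibleF B f) (hu : IsC1Closure Ω u)
    (husol : IsWeakSolution B H f Ω u) (hupos : ∀ x ∈ Ω, 0 < u x)
    (hubd : ∀ x ∈ frontier Ω, u x = 0) (hy : y ∈ frontier Ω)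
    (hS : IsInteriorSphere Ω y ν R) : HasPosDirDeriv u y ν := by
  obtain ⟨d, hd⟩ := hu.hasDerivWithinAt (frontier_subset_closure hy) hS
  obtain ⟨hR, hν, hball⟩ := id hS
  set c := y + R • ν with hc
  have hunn : ∀ x ∈ closure Ω, 0 ≤ u x := by
    intro x hx
    by_cases hxΩ : x ∈ Ω
    · exact (hupos x hxΩ).le
    · exact (hubd x (by rw [hΩ.frontier_eq]; exact ⟨hx, hxΩ⟩)).ge
  have hinner : Metric.sphere c (R / 2) ⊆ Ω := fun x hx => hball <| by
    rw [mem_sphere_iff_norm] at hx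
    rw [mem_ball_iff_norm, hx]; linarith
  obtain ⟨ε, hε, hεu⟩ := (isCompact_sphere c (R / 2)).exists_forall_le'
    (hu.1.mono (hinner.trans subset_closure)) fun x hx => hupos x (hinner hx)
  let b := EuclideanSpace.basisFun (Fin n) ℝ
  obtain ⟨α, hα, hsub⟩ := exists_sum_fderiv_barrier_flux_neg hB hH c (r₀ := R / 2) (r := R)
    (by positivity) b
  set U : Set (EuclideanSpace ℝ (Fin n)) := {x | R / 2 < ‖x - c‖ ∧ ‖x - c‖ < R} with hUdef
  have hnc : Continuous fun x : EuclideanSpace ℝ (Fin n) => ‖x - c‖ := by fun_prop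
  have hU : IsOpen U := (isOpen_lt continuous_const hnc).inter (isOpen_lt hnc continuous_const)
  have hUball : U ⊆ Metric.ball c R := fun x hx => by
    rw [mem_ball_iff_norm]; exact hx.2
  have hUcl : closure U ⊆ {x | R / 2 ≤ ‖x - c‖ ∧ ‖x - c‖ ≤ R} :=
    closure_minimal (fun x hx => ⟨hx.1.le, hx.2.le⟩)
      ((isClosed_le continuous_const hnc).inter (isClosed_le hnc continuous_const))
  have hbd : ∀ x ∈ frontier U, barrier c R α ε x ≤ u x := by
    intro x hx
    have hxcl : x ∈ closure Ω := closure_mono (hUball.trans hball) (frontier_subset_closure hx)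
    rw [hU.frontier_eq] at hx
    obtain ⟨h1, h2⟩ := hUcl hx.1
    rcases eq_or_lt_of_le h1 with h3 | h3
    · have h4 : barrier c R α ε x ≤ ε := by
        have e1 : Real.exp (-α * ‖x - c‖ ^ 2) ≤ 1 :=
          Real.exp_le_one_iff.2 (by nlinarith [sq_nonneg ‖x - c‖])
        have e2 := Real.exp_pos (-α * R ^ 2)
        unfold barrier
        nlinarith
      exact h4.trans (hεu x (by rw [mem_sphere_iff_norm, ← h3]))
    · rcases eq_or_lt_of_le h2 with h4 | h4
      · simpa [barrier, h4] using hunn x hxcl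
      · exact absurd ⟨h3, h4⟩ hx.2
  have hcmp := barrier_le hB hH hα hε b hΩ hU (hUball.trans hball)
    (Metric.isBounded_ball.subset hUball)
    (fun h => by have := h.1; simp at this; linarith)
    (fun x hx => hsub ε hε x hx.1.le hx.2.le) hu husol
    (fun x hx => hf.nonneg _ (hupos x hx).le) hbd
  have hline : HasDerivAt (fun t : ℝ => y + t • ν) ν 0 := by
    simpa using ((hasDerivAt_id (0 : ℝ)).smul_const ν).const_add y
  have hvd : HasDerivAt (fun t : ℝ => barrier c R α ε (y + t • ν))
      (barrierSlope c α ε y * R) 0 := by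
    have h1 : HasFDerivAt (barrier c R α ε) (fderiv ℝ (barrier c R α ε) y)
        (y + (0 : ℝ) • ν) := by
      rw [zero_smul, add_zero]
      exact ((contDiff_barrier c R α ε).differentiable (by norm_num) y).hasFDerivAt
    have h2 := h1.comp_hasDerivAt (0 : ℝ) hline
    rw [← inner_gradient_left, gradient_barrier] at h2
    refine h2.congr_deriv ?_
    simp [hc, real_inner_smul_left, hν]
  refine ⟨d, hd, lt_of_lt_of_le (mul_pos (barrierSlope_pos c hα hε y) hR)
    (le_of_hasDerivWithinAt_Ici hvd.hasDerivWithinAt hd ?_ ?_)⟩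
  · have : ‖y - c‖ = R := by simp [hc, norm_smul, hν, abs_of_pos hR]
    simp [barrier, this, hubd y hy]
  · filter_upwards [Ioo_mem_nhdsGT (show (0 : ℝ) < R / 2 by positivity)] with t ht
    refine hcmp _ ?_
    have h1 : ‖y + t • ν - c‖ = R - t := by
      rw [hc, norm_add_smul_sub_add_smul hν, abs_of_neg (by linarith [ht.2])]; ring
    exact ⟨by rw [h1]; linarith [ht.2], by rw [h1]; linarith [ht.1]⟩

/-- The inner unit normal to `∂Ω` is the inner unit normal of every interior sphere. -/
theorem IsInnerUnitNormal.eq_of_isInteriorSphere {ν' : EuclideanSpace ℝ (Fin n)}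
    (hN : IsInnerUnitNormal Ω y ν) (hS : IsInteriorSphere Ω y ν' R) : ν = ν' := by
  by_contra hne
  obtain ⟨hν, hN⟩ := hN
  obtain ⟨hR, hν', hball⟩ := hS
  have hlt : inner ℝ ν ν' < (1 : ℝ) := (inner_lt_one_iff_real_of_norm_eq_one hν hν').2 hne
  -- If the normals differ, `w` points into the ball (`⟨w, ν'⟩ = s > 0`) but strictly out of the
  -- half-space of `ν` (`⟨w, ν⟩ = -s`). Points `y + t w` with small `t > 0` are then both in and out
  -- of `Ω`.
  set w := ν' - ν with hw
  set s := 1 - inner ℝ ν ν' with hs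
  have hspos : 0 < s := by linarith
  have hwν : inner ℝ w ν = -s := by
    rw [hw, inner_sub_left, real_inner_self_eq_norm_sq, hν, real_inner_comm]; ring
  have hwν' : inner ℝ w ν' = s := by
    rw [hw, inner_sub_left, real_inner_self_eq_norm_sq, hν']; ring
  have hw2 : ‖w‖ ^ 2 = 2 * s := by
    rw [← real_inner_self_eq_norm_sq, hw, inner_sub_right, ← hw, hwν, hwν']; ring
  have hwpos : 0 < ‖w‖ := by
    by_contra h
    have : ‖w‖ = 0 := le_antisymm (not_lt.1 h) (norm_nonneg _)
    rw [this] at hw2; linarith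
  have hcont : Tendsto (fun t : ℝ => y + t • w) (𝓝[>] 0) (𝓝 y) := by
    have : Continuous fun t : ℝ => y + t • w := by fun_prop
    simpa using (this.tendsto 0).mono_left nhdsWithin_le_nhds
  -- Half of `s / ‖w‖`, the value at which the cone condition along `w` would become an equality.
  have hev := hcont.eventually (hN (s / (2 * ‖w‖)) (by positivity))
  obtain ⟨t, ⟨-, h2⟩, ht⟩ := (hev.and (Ioo_mem_nhdsGT hR)).exists
  have ht0 : 0 < t := ht.1
  refine h2 ?_ (hball ?_)
  · rw [add_sub_cancel_left, real_inner_smul_left, hwν, norm_smul, Real.norm_eq_abs,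
      abs_of_pos ht0]
    have : s / (2 * ‖w‖) * (t * ‖w‖) = s * t / 2 := by field_simp
    rw [this]
    nlinarith [mul_pos hspos ht0]
  · rw [mem_ball_iff_norm, add_sub_add_left_eq_sub]
    refine lt_of_pow_lt_pow_left₀ 2 hR.le ?_
    rw [norm_sub_sq_real, real_inner_smul_left, real_inner_smul_right, hwν', norm_smul,
      norm_smul, hν', mul_pow, hw2, Real.norm_eq_abs, Real.norm_eq_abs, sq_abs, mul_one, sq_abs]
    -- Since `‖w‖² = 2 s`, `‖t w - R ν'‖² = R² - 2 s t (R - t)`, which is below `R²` for `0 < t <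
    -- R`.
    nlinarith [mul_pos (mul_pos hspos ht0) (sub_pos.2 ht.2)]

theorem InteriorSphereCondition.exists_isInteriorSphere (h : InteriorSphereCondition Ω y) :
    ∃ ν R, IsInteriorSphere Ω y ν R := by
  obtain ⟨c, R, hR, hball, hy⟩ := h
  rw [mem_sphere_iff_norm] at hy
  refine ⟨R⁻¹ • (c - y), R, hR, ?_, ?_⟩
  · rw [norm_smul, norm_sub_rev, hy, norm_inv, Real.norm_eq_abs, abs_of_pos hR,
      inv_mul_cancel₀ hR.ne']
  · rwa [smul_inv_smul₀ hR.ne', add_sub_cancel]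

end Hopf

end AnisotropicHopf

theorem mainTheorem1 {n : ℕ} (hn : 2 ≤ n)
    (Ω : Set (EuclideanSpace ℝ (Fin n))) (hΩo : IsOpen Ω) (hΩc : IsConnected Ω)
    (hΩb : Bornology.IsBounded Ω)
    (β : ℝ≥0) (hβ0 : 0 < β) (hβ1 : β < 1)
    (B : ℝ → ℝ) (hB : AnisotropicHopf.AdmissibleB β B)
    (H : EuclideanSpace ℝ (Fin n) → ℝ) (hH : AnisotropicHopf.AdmissibleH β H)
    (f : ℝ → ℝ) (hf : AnisotropicHopf.AdmissibleF B f)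
    (u : EuclideanSpace ℝ (Fin n) → ℝ) (huC1 : AnisotropicHopf.IsC1Closure Ω u)
    (husol : AnisotropicHopf.IsWeakSolution B H f Ω u)
    (hupos : ∀ x ∈ Ω, 0 < u x) (hubd : ∀ x ∈ frontier Ω, u x = 0)
    (y : EuclideanSpace ℝ (Fin n)) (hy : y ∈ frontier Ω)
    (hsphere : AnisotropicHopf.InteriorSphereCondition Ω y) :
    (∀ ν, AnisotropicHopf.IsInnerUnitNormal Ω y ν → AnisotropicHopf.HasPosDirDeriv u y ν) ∧
    (∀ ν R, AnisotropicHopf.IsInteriorSphere Ω y ν R → AnisotropicHopf.HasPosDirDeriv u y ν) := by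
  have hmain : ∀ ν R, AnisotropicHopf.IsInteriorSphere Ω y ν R →
      AnisotropicHopf.HasPosDirDeriv u y ν := fun ν R hS =>
    AnisotropicHopf.hasPosDirDeriv_of_isInteriorSphere hΩo hB hH hf huC1 husol hupos hubd hy hS
  refine ⟨fun ν hν => ?_, hmain⟩
  obtain ⟨ν', R, hS⟩ := hsphere.exists_isInteriorSphere
  rw [hν.eq_of_isInteriorSphere hS]
  exact hmain ν' R hS
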